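/- Let $(\Omega,\Sigma,\mu)$ be a complete probability space, let $X$ and $Y$ be real Banach spaces, and let $1\le p<\infty$. Write $B_{X^*}$ for the closed unit ball of $X^*$ and $w^*$ for the weak$^*$ topology. A compact Hausdorff space $K$ belongs to the class $MS$ if every regular Borel probability measure $\eta$ on $K$ is separable, i.e. there is a countable family of Borel sets that is dense in the measure algebra of $\eta$ for the metric $d(A,B)=\eta(A\triangle B)$. A continuous linear map $u:X\to Y$ is $p$-summing if there is a constant $K\ge 0$ such that $$\Big(\sum_{i=1}^n\|u(x_i)\|_Y^p\Big)^{1/p}\le K\,\sup_{x^*\in B_{X^*}}\Big(\sum_{i=1}^n|\langle x_i,x^*\rangle|^p\Big)^{1/p}$$ for all $n$ and all $x_1,\dots,x_n\in X$; the least such $K$ is denoted by $\pi_p(u)$. A function $f:\Omega\to X$ is $p$-Dunford integrable if $\langle f,x^*\rangle\in L^p(\mu)$ for every $x^*\in X^*$, and then $$\|f\|_{\mathscr D^p(\mu,X)}:=\sup_{x^*\in B_{X^*}}\Big(\int_\Omega|\langle f,x^*\rangle|^p\,d\mu\Big)^{1/p}.$$ A function $g:\Omega\to Y$ is $p$-Bochner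 integrable if it is strongly measurable (a $\mu$-a.e. norm limit of a sequence of simple functions) and $\|g(\cdot)\|_Y\in L^p(\mu)$, and then $\|g\|_{L^p(\mu,Y)}:=\big(\int_\Omega\|g(\cdot)\|_Y^p\,d\mu\big)^{1/p}$. Suppose that $(B_{X^*},w^*)$ belongs to the class $MS$. Let $u:X\to Y$ be a $p$-summing operator. If $f:\Omega\to X$ is $p$-Dunford integrable, then $u\circ f$ is $p$-Bochner integrable and $$\|u\circ f\|_{L^p(\mu,Y)}\le \pi_p(u)\,\|f\|_{\mathscr D^p(\mu,X)}.$$ -/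

import Mathlib

open MeasureTheory
open scoped ENNReal

noncomputable section

/-- The closed unit ball `B_{X*}` of the dual of a real normed space `X`, as a subset of the dual
equipped with the weak* topology. Coerced to a type it carries the (subspace) weak* topology. -/
def weakStarDualBall (X : Type*) [NormedAddCommGroup X] [NormedSpace ℝ X] : Set (WeakDual ℝ X) :=
  WeakDual.toStrongDual ⁻¹' Metric.closedBall (0 : StrongDual ℝ X) 1

/-- Banach-Alaoglu: `(B_{X*}, w*)` is compact. -/
instance weakStarDualBall.instCompactSpace (X : Type*) [NormedAddCommGroup X] [NormedSpace ℝ X] :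
    CompactSpace (weakStarDualBall X) :=
  isCompact_iff_compactSpace.mp (WeakDual.isCompact_closedBall (𝕜 := ℝ) (0 : StrongDual ℝ X) 1)

/-- A compact Hausdorff space `K` belongs to the class `MS` if every regular Borel probability
measure on `K` is separable, i.e. admits a countable family of measurable sets that is dense in its
measure algebra for the Fréchet-Nikodým metric. -/
def IsClassMS (K : Type*) [TopologicalSpace K] [CompactSpace K] [T2Space K] : Prop :=
  ∀ [MeasurableSpace K] [BorelSpace K] (η : Measure K) [IsProbabilityMeasure η] [η.Regular],
    IsSeparable η

section Summing

variable {X Y : Type*} [NormedAddCommGroup X] [NormedSpace ℝ X]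
  [NormedAddCommGroup Y] [NormedSpace ℝ Y]

/-- The weak `p`-norm `sup {(∑ i, |⟨x i, φ⟩| ^ p) ^ (1 / p) : φ ∈ B_{X*}}` of a finite family.
The supremum is that of a non-empty set which is bounded (by `(∑ i, ‖x i‖ ^ p) ^ (1 / p)`). -/
def weakLpNorm (p : ℝ) {n : ℕ} (x : Fin n → X) : ℝ :=
  ⨆ φ : Metric.closedBall (0 : StrongDual ℝ X) 1, (∑ i, |φ.1 (x i)| ^ p) ^ (1 / p)

/-- The constants `K ≥ 0` admissible in the definition of a `p`-summing operator. -/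
def summingConstants (p : ℝ) (u : X →L[ℝ] Y) : Set ℝ :=
  {K | 0 ≤ K ∧ ∀ (n : ℕ) (x : Fin n → X), (∑ i, ‖u (x i)‖ ^ p) ^ (1 / p) ≤ K * weakLpNorm p x}

/-- `u` is `p`-summing: some constant `K ≥ 0` is admissible. -/
def IsPSumming (p : ℝ) (u : X →L[ℝ] Y) : Prop :=
  (summingConstants p u).Nonempty

/-- `π_p(u)`, the least admissible constant (the set of admissible constants is closed and bounded
below by `0`, so for a `p`-summing `u` the infimum is attained). -/
def piSumming (p : ℝ) (u : X →L[ℝ] Y) : ℝ :=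
  sInf (summingConstants p u)

end Summing

section Dunford

variable {Ω X : Type*} [MeasurableSpace Ω] [NormedAddCommGroup X] [NormedSpace ℝ X]

/-- `f` is `p`-Dunford integrable: `⟨f, φ⟩ ∈ L^p(μ)` for every `φ ∈ X*`. -/
def IsPDunfordIntegrable (p : ℝ) (μ : Measure Ω) (f : Ω → X) : Prop :=
  ∀ φ : StrongDual ℝ X, MemLp (fun ω => φ (f ω)) (ENNReal.ofReal p) μ

/-- The norm `sup {(∫ |⟨f, φ⟩| ^ p ∂μ) ^ (1 / p) : φ ∈ B_{X*}}`, as an extended real number. -/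
def pDunfordNorm (p : ℝ) (μ : Measure Ω) (f : Ω → X) : ℝ≥0∞ :=
  ⨆ φ : Metric.closedBall (0 : StrongDual ℝ X) 1,
    eLpNorm (fun ω => φ.1 (f ω)) (ENNReal.ofReal p) μ

end Dunford

end

/-! Two things are needed: strong measurability of `u ∘ f`, and the norm bound.

By Pietsch domination, `‖u x‖` is at most a constant times the norm of `x` in `L^p(η)`, for some
regular probability `η` on the weak* dual ball. Class `MS` makes `L^p(η)` separable, so the range of
`u` is separable, and Pettis' theorem applies to `u ∘ f`.

The bound cannot come from simple functions approximating `f`, which need not be strongly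
measurable, nor directly from Fubini, since `(ω, φ) ↦ φ (f ω)` need not be jointly measurable.
Instead `Ω` is cut into pieces `A i` on which `u ∘ f` is almost constant. Hahn–Banach supplies
points `x i` in the convex hulls of the `f '' A i` such that the family `μ(A i)^(1/p) x i` has weak
`ℓ^p` norm almost at most the Dunford norm of `f` (`exists_mem_convexHull_norm_sum_lt`). Balls are
convex, so `u (x i)` stays close to `u ∘ f` on `A i`, and the `p`-summing inequality for this finite
family becomes the integral bound. -/

/-! ### Finite families with controlled weak `ℓ^p` norm -/

/-- A finite-dimensional space is almost normed by finitely many functionals of norm at most `1`. -/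
theorem exists_finite_almost_norming {E : Type*} [NormedAddCommGroup E] [NormedSpace ℝ E]
    [FiniteDimensional ℝ E] {δ : ℝ} (hδ : 0 < δ) :
    ∃ S : Finset (StrongDual ℝ E), (∀ s ∈ S, ‖s‖ ≤ 1) ∧
      ∀ (v : E) (R : ℝ), 0 ≤ R → (∀ s ∈ S, s v ≤ R) → ‖v‖ ≤ (1 + δ) * R := by
  have hc : IsCompact (Metric.sphere (0 : E) 1) := isCompact_sphere 0 1
  choose g hg1 hg2 using fun v : E => exists_dual_vector'' ℝ v
  -- A functional norming `v` still almost norms the unit vectors near `v`; compactness of the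
  -- sphere leaves finitely many.
  obtain ⟨t, -, ht2⟩ := hc.elim_nhds_subcover (fun v => {w | 1 < (1 + δ) * g v w}) (by
    intro v hv
    refine (isOpen_lt continuous_const (by fun_prop)).mem_nhds ?_
    have : g v v = 1 := by rw [hg2]; simpa using hv
    simp only [Set.mem_ofPred_eq, this]; linarith)
  classical
  refine ⟨t.image g, by simpa using fun a _ => hg1 a, fun v R hR h => ?_⟩
  rcases eq_or_ne v 0 with rfl | hv
  · simpa using by positivity
  have hv' : 0 < ‖v‖ := norm_pos_iff.2 hv
  have hs : ‖v‖⁻¹ • v ∈ Metric.sphere (0 : E) 1 := by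
    simp [norm_smul, hv'.ne']
  obtain ⟨a, ha, hav⟩ : ∃ a ∈ t, 1 < (1 + δ) * g a (‖v‖⁻¹ • v) := by simpa using ht2 hs
  have h1 := h (g a) (Finset.mem_image_of_mem g ha)
  rw [map_smul, smul_eq_mul] at hav
  have h2 : ‖v‖ * 1 < ‖v‖ * ((1 + δ) * (‖v‖⁻¹ * g a v)) := by gcongr
  have h3 : ‖v‖ * ((1 + δ) * (‖v‖⁻¹ * g a v)) = (1 + δ) * g a v := by field_simp
  nlinarith

/-- Finitely many functionals almost norm `ℓ^p(ι)`. -/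
theorem exists_finite_almost_norming_lp (ι : Type*) [Fintype ι] {p : ℝ} (hp : 1 ≤ p) {δ : ℝ}
    (hδ : 0 < δ) :
    ∃ (n : ℕ) (b : Fin n → ι → ℝ),
      (∀ s (v : ι → ℝ), ∑ i, b s i * v i ≤ (∑ i, |v i| ^ p) ^ (1 / p)) ∧
      ∀ (v : ι → ℝ) (R : ℝ), 0 ≤ R → (∀ s, ∑ i, b s i * v i ≤ R) →
        (∑ i, |v i| ^ p) ^ (1 / p) ≤ (1 + δ) * R := by
  classical
  have : Fact (1 ≤ ENNReal.ofReal p) := ⟨by simpa using hp⟩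
  have hnorm (v : ι → ℝ) : ‖WithLp.toLp (ENNReal.ofReal p) v‖ = (∑ i, |v i| ^ p) ^ (1 / p) := by
    rw [PiLp.norm_eq_sum (by simpa [ENNReal.toReal_ofReal (by linarith : 0 ≤ p)] using by linarith)]
    simp [ENNReal.toReal_ofReal (by linarith : 0 ≤ p)]
  obtain ⟨S, hS1, hS2⟩ := exists_finite_almost_norming
    (E := PiLp (ENNReal.ofReal p) (fun _ : ι => ℝ)) hδ
  let e := S.equivFin.symm
  have hrep (s : StrongDual ℝ (PiLp (ENNReal.ofReal p) (fun _ : ι => ℝ))) (v : ι → ℝ) :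
      s (WithLp.toLp _ v) = ∑ i, s (WithLp.toLp _ (Pi.single i 1)) * v i := by
    conv_lhs => rw [pi_eq_sum_univ' v]
    simp only [WithLp.toLp_sum, WithLp.toLp_smul, map_sum, map_smul, smul_eq_mul]
    refine Finset.sum_congr rfl fun i _ => ?_
    rw [mul_comm]
  refine ⟨S.card, fun s i => (e s).1 (WithLp.toLp _ (Pi.single i 1)), fun s v => ?_,
    fun v R hR h => ?_⟩
  · rw [← hrep, ← hnorm]
    refine (le_abs_self _).trans (((e s).1.le_opNorm _).trans ?_)
    have := hS1 _ (e s).2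
    nlinarith [norm_nonneg (WithLp.toLp (ENNReal.ofReal p) v)]
  · rw [← hnorm]
    refine hS2 _ R hR fun s hs => ?_
    have := h (e.symm ⟨s, hs⟩)
    rwa [← hrep, Equiv.apply_symm_apply] at this

/-- A continuous functional on a normed space almost attains its norm on a ball. -/
theorem exists_norm_lt_mul_le {X : Type*} [NormedAddCommGroup X] [NormedSpace ℝ X]
    (φ : StrongDual ℝ X) {M M' : ℝ} (h0 : 0 ≤ M) (h : M < M') :
    ∃ z : X, ‖z‖ < M' ∧ ‖φ‖ * M ≤ φ z := by
  rcases eq_or_ne φ 0 with rfl | hφ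
  · exact ⟨0, by simpa using h0.trans_lt h, by simp⟩
  obtain ⟨x, hx1, hx2⟩ : ∃ x : X, ‖x‖ < 1 ∧ ‖φ‖ * M / M' < ‖φ x‖ := by
    apply φ.exists_lt_apply_of_lt_opNorm
    rw [div_lt_iff₀ (h0.trans_lt h)]
    exact mul_lt_mul_of_pos_left h (norm_pos_iff.2 hφ)
  have hM' := h0.trans_lt h
  rw [div_lt_iff₀ hM', Real.norm_eq_abs] at hx2
  rcases abs_cases (φ x) with ⟨h1, -⟩ | ⟨h1, -⟩
  · refine ⟨M' • x, ?_, ?_⟩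
    · rw [norm_smul, Real.norm_of_nonneg hM'.le]; nlinarith
    · rw [map_smul, smul_eq_mul]; nlinarith
  · refine ⟨(-M') • x, ?_, ?_⟩
    · rw [norm_smul, norm_neg, Real.norm_of_nonneg hM'.le]; nlinarith
    · rw [map_smul, smul_eq_mul]; nlinarith

/-- Averaging over disjoint sets is a contraction of `L^p`: Jensen's inequality on each set, then
summation. -/
theorem sum_rpow_setAverage_le_eLpNorm {Ω : Type*} [MeasurableSpace Ω] {μ : Measure Ω}
    [IsFiniteMeasure μ] {ι : Type*} [Fintype ι] {A : ι → Set Ω} (hA : ∀ i, MeasurableSet (A i))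
    (hd : Pairwise (Function.onFun Disjoint A)) (h0 : ∀ i, μ (A i) ≠ 0) {p : ℝ} (hp : 1 ≤ p)
    {h : Ω → ℝ} (hh : MemLp h (ENNReal.ofReal p) μ) :
    (∑ i, |μ.real (A i) ^ (1 / p) * ⨍ ω in A i, h ω ∂μ| ^ p) ^ (1 / p) ≤
      (eLpNorm h (ENNReal.ofReal p) μ).toReal := by
  have hp0 : 0 < p := by linarith
  have hint : Integrable (fun ω => ‖h ω‖ ^ p) μ := by
    have := hh.integrable_norm_rpow (by simpa using hp0) (by simp)
    rwa [ENNReal.toReal_ofReal hp0.le] at this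
  have hh1 : Integrable h μ := hh.integrable (by simpa using hp)
  rw [hh.eLpNorm_eq_integral_rpow_norm (by simpa using hp0) (by simp),
    ENNReal.toReal_ofReal hp0.le, ENNReal.toReal_ofReal (by positivity), one_div]
  refine Real.rpow_le_rpow (by positivity) ?_ (by positivity)
  calc ∑ i, |μ.real (A i) ^ p⁻¹ * ⨍ ω in A i, h ω ∂μ| ^ p
      ≤ ∑ i, ∫ ω in A i, ‖h ω‖ ^ p ∂μ := by
        refine Finset.sum_le_sum fun i _ => ?_
        have h1 : |⨍ ω in A i, h ω ∂μ| ≤ ⨍ ω in A i, ‖h ω‖ ∂μ := by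
          simp only [average]
          exact norm_integral_le_integral_norm h
        have h2 : (⨍ ω in A i, ‖h ω‖ ∂μ) ^ p ≤ ⨍ ω in A i, ‖h ω‖ ^ p ∂μ :=
          (convexOn_rpow hp).map_set_average_le
            (Real.continuous_rpow_const hp0.le).continuousOn isClosed_Ici (h0 i)
            (measure_ne_top _ _) (by simp) hh1.norm.integrableOn hint.integrableOn
        rw [abs_mul, abs_of_nonneg (by positivity), Real.mul_rpow (by positivity) (by positivity),
          Real.rpow_inv_rpow measureReal_nonneg hp0.ne',
          ← measure_smul_setAverage _ (measure_ne_top _ _), smul_eq_mul]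
        exact mul_le_mul_of_nonneg_left
          ((Real.rpow_le_rpow (abs_nonneg _) h1 hp0.le).trans h2) measureReal_nonneg
    _ = ∫ ω in ⋃ i, A i, ‖h ω‖ ^ p ∂μ :=
        (integral_iUnion_fintype hA hd fun i => hint.integrableOn).symm
    _ ≤ ∫ ω, ‖h ω‖ ^ p ∂μ :=
        setIntegral_le_integral hint (Filter.Eventually.of_forall fun _ => by positivity)

/-- Selection of points in the convex hulls of the images of a finite family of sets, uniformly
controlled on finitely many linear combinations. -/
theorem exists_mem_convexHull_norm_sum_lt {Ω X : Type*} [MeasurableSpace Ω] {μ : Measure Ω}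
    [IsFiniteMeasure μ] [NormedAddCommGroup X] [NormedSpace ℝ X] {ι : Type*} [Fintype ι]
    {A : ι → Set Ω} (hA : ∀ i, MeasurableSet (A i))
    (hd : Pairwise (Function.onFun Disjoint A)) (h0 : ∀ i, μ (A i) ≠ 0) {p : ℝ} (hp : 1 ≤ p)
    {f : Ω → X} (hf : IsPDunfordIntegrable p μ f) {M M' : ℝ} (hM : 0 ≤ M) (hMM' : M < M')
    (hfM : ∀ φ : StrongDual ℝ X,
      (eLpNorm (fun ω => φ (f ω)) (ENNReal.ofReal p) μ).toReal ≤ ‖φ‖ * M)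
    {n : ℕ} (b : Fin n → ι → ℝ)
    (hb : ∀ s (v : ι → ℝ), ∑ i, b s i * v i ≤ (∑ i, |v i| ^ p) ^ (1 / p)) :
    ∃ x : ι → X, (∀ i, x i ∈ convexHull ℝ (f '' A i)) ∧
      ∀ s, ‖∑ i, b s i • μ.real (A i) ^ (1 / p) • x i‖ < M' := by
  classical
  let T : (ι → X) →ₗ[ℝ] (Fin n → X) :=
    { toFun x s := ∑ i, b s i • μ.real (A i) ^ (1 / p) • x i
      map_add' x y := by ext s; simp [Finset.sum_add_distrib]
      map_smul' c x := by
        ext s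
        simp only [Pi.smul_apply, RingHom.id_apply, Finset.smul_sum]
        exact Finset.sum_congr rfl fun i _ => by module }
  let D : Set (ι → X) := Set.univ.pi fun i => convexHull ℝ (f '' A i)
  have hMpos := hM.trans_lt hMM'
  by_contra hcon
  have hdisj : Disjoint (Metric.ball (0 : Fin n → X) M') (T '' D) := by
    rw [Set.disjoint_left]
    rintro _ hz ⟨x, hx, rfl⟩
    refine hcon ⟨x, fun i => hx i trivial, fun s => ?_⟩
    exact (norm_le_pi_norm (T x) s).trans_lt (by simpa using hz)
  -- If no choice works, the ball of radius `M'` in `X^n` is separated from the convex set of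
  -- attainable values; only finitely many combinations occur, so `Φ` is a tuple of functionals `φ
  -- s`.
  obtain ⟨Φ, c, hΦ1, hΦ2⟩ := geometric_hahn_banach_open (convex_ball _ _) Metric.isOpen_ball
    ((convex_pi fun i _ => convex_convexHull ℝ _).linear_image T) hdisj
  let φ (s : Fin n) : StrongDual ℝ X := Φ.comp (ContinuousLinearMap.single ℝ (fun _ => X) s)
  have hΦ (z : Fin n → X) : Φ z = ∑ s, φ s (z s) := by
    conv_lhs => rw [← Finset.univ_sum_single z]
    rw [map_sum]; rfl
  choose z hz1 hz2 using fun s => exists_norm_lt_mul_le (φ s) hM hMM'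
  have h1 : Φ z < c := hΦ1 z (by simpa using (pi_norm_lt_iff hMpos).2 hz1)
  let ψ (i : ι) : StrongDual ℝ X := ∑ s, (b s i * μ.real (A i) ^ (1 / p)) • φ s
  have hint (χ : StrongDual ℝ X) : Integrable (fun ω => χ (f ω)) μ :=
    (hf χ).integrable (by simpa using hp)
  -- A scalar function is at most its mean somewhere on `A i`. These points put an attainable value
  -- of `Φ` below the sum of the `‖φ s‖ * M`, contradicting the separation.
  have hsel (i : ι) : ∃ ω ∈ A i, ψ i (f ω) ≤ ⨍ ω in A i, ψ i (f ω) ∂μ :=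
    exists_le_setAverage (h0 i) (measure_ne_top _ _) (hint _).integrableOn
  choose ω hω1 hω2 using hsel
  have h2 : c ≤ Φ (T fun i => f (ω i)) :=
    hΦ2 _ ⟨_, fun i _ => subset_convexHull ℝ _ ⟨_, hω1 i, rfl⟩, rfl⟩
  have h3 : Φ (T fun i => f (ω i)) = ∑ i, ψ i (f (ω i)) := by
    rw [hΦ]
    simp only [T, ψ, LinearMap.coe_mk, AddHom.coe_mk, map_sum, map_smul, smul_eq_mul,
      sum_apply, smul_apply]
    rw [Finset.sum_comm]
    simp only [mul_assoc]
  have h4 : ∑ i, ⨍ ω in A i, ψ i (f ω) ∂μ =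
      ∑ s, ∑ i, b s i * (μ.real (A i) ^ (1 / p) * ⨍ ω in A i, φ s (f ω) ∂μ) := by
    rw [Finset.sum_comm]
    refine Finset.sum_congr rfl fun i _ => ?_
    simp only [ψ, sum_apply, smul_apply, smul_eq_mul,
      setAverage_eq]
    rw [integral_finsetSum _ fun s _ => ((hint (φ s)).integrableOn.const_mul _),
      Finset.mul_sum]
    refine Finset.sum_congr rfl fun s _ => ?_
    rw [integral_const_mul]
    ring
  have h5 : ∑ i, ψ i (f (ω i)) ≤ ∑ s, φ s (z s) := by
    refine (Finset.sum_le_sum fun i _ => hω2 i).trans (h4.trans_le ?_)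
    refine Finset.sum_le_sum fun s _ => (hb s _).trans ?_
    exact (sum_rpow_setAverage_le_eLpNorm hA hd h0 hp (hf (φ s))).trans ((hfM _).trans (hz2 s))
  rw [hΦ] at h1
  linarith

theorem weakLpNorm_le {X : Type*} [NormedAddCommGroup X] [NormedSpace ℝ X] {p : ℝ} {n : ℕ}
    {x : Fin n → X} {R : ℝ}
    (h : ∀ φ : StrongDual ℝ X, ‖φ‖ ≤ 1 → (∑ i, |φ (x i)| ^ p) ^ (1 / p) ≤ R) :
    weakLpNorm p x ≤ R :=
  have : Nonempty (Metric.closedBall (0 : StrongDual ℝ X) 1) := ⟨⟨0, by simp⟩⟩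
  ciSup_le fun φ => h φ.1 (mem_closedBall_zero_iff.1 φ.2)

theorem sum_rpow_le_of_mem_summingConstants {X Y : Type*} [NormedAddCommGroup X] [NormedSpace ℝ X]
    [NormedAddCommGroup Y] [NormedSpace ℝ Y] {p : ℝ} {u : X →L[ℝ] Y} {C : ℝ}
    (hC : C ∈ summingConstants p u) {ι : Type*} [Fintype ι] (x : ι → X) {R : ℝ}
    (h : ∀ φ : StrongDual ℝ X, ‖φ‖ ≤ 1 → (∑ i, |φ (x i)| ^ p) ^ (1 / p) ≤ R) :
    (∑ i, ‖u (x i)‖ ^ p) ^ (1 / p) ≤ C * R := by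
  let e := (Fintype.equivFin ι).symm
  have := hC.2 _ (x ∘ e)
  simp only [Function.comp_apply, e.sum_comp fun i => ‖u (x i)‖ ^ p] at this
  refine this.trans (mul_le_mul_of_nonneg_left (weakLpNorm_le fun φ hφ => ?_) hC.1)
  simpa only [Function.comp_apply, e.sum_comp fun i => |φ (x i)| ^ p] using h φ hφ

/-- By `ℓ^p` duality, the norms of finitely many combinations `∑ b s i • x i` control the weak `ℓ^p`
norm up to the factor `1 + δ`; the summing inequality then applies. -/
theorem exists_mem_convexHull_sum_rpow_le {Ω X Y : Type*} [MeasurableSpace Ω] {μ : Measure Ω}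
    [IsFiniteMeasure μ] [NormedAddCommGroup X] [NormedSpace ℝ X]
    [NormedAddCommGroup Y] [NormedSpace ℝ Y] {ι : Type*} [Fintype ι]
    {A : ι → Set Ω} (hA : ∀ i, MeasurableSet (A i))
    (hd : Pairwise (Function.onFun Disjoint A)) (h0 : ∀ i, μ (A i) ≠ 0) {p : ℝ} (hp : 1 ≤ p)
    {f : Ω → X} (hf : IsPDunfordIntegrable p μ f) {M δ : ℝ} (hM : 0 ≤ M) (hδ : 0 < δ)
    (hfM : ∀ φ : StrongDual ℝ X,
      (eLpNorm (fun ω => φ (f ω)) (ENNReal.ofReal p) μ).toReal ≤ ‖φ‖ * M)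
    {u : X →L[ℝ] Y} {C : ℝ} (hC : C ∈ summingConstants p u) :
    ∃ x : ι → X, (∀ i, x i ∈ convexHull ℝ (f '' A i)) ∧
      (∑ i, (μ.real (A i) ^ (1 / p) * ‖u (x i)‖) ^ p) ^ (1 / p) ≤
        C * ((1 + δ) * (M + δ)) := by
  obtain ⟨n, b, hb1, hb2⟩ := exists_finite_almost_norming_lp ι hp hδ
  obtain ⟨x, hx1, hx2⟩ := exists_mem_convexHull_norm_sum_lt hA hd h0 hp hf hM
    (lt_add_of_pos_right M hδ) hfM b hb1
  refine ⟨x, hx1, ?_⟩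
  have := sum_rpow_le_of_mem_summingConstants hC (fun i => μ.real (A i) ^ (1 / p) • x i)
    (R := (1 + δ) * (M + δ)) fun φ hφ => hb2 _ _ (by positivity) fun s => ?_
  · simpa [norm_smul, abs_of_nonneg, Real.rpow_nonneg] using this
  · calc ∑ i, b s i * φ (μ.real (A i) ^ (1 / p) • x i)
        = φ (∑ i, b s i • μ.real (A i) ^ (1 / p) • x i) := by simp
      _ ≤ ‖φ‖ * ‖∑ i, b s i • μ.real (A i) ^ (1 / p) • x i‖ :=
        (le_abs_self _).trans (φ.le_opNorm _)
      _ ≤ 1 * (M + δ) := by gcongr; exact (hx2 s).le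
      _ = M + δ := one_mul _

/-! ### Pietsch domination and separability of the range -/

section Pietsch

variable {X Y : Type*} [NormedAddCommGroup X] [NormedSpace ℝ X]
  [NormedAddCommGroup Y] [NormedSpace ℝ Y]

/-- Evaluation at a point, as a continuous function on the weak* compact dual ball. -/
noncomputable def weakStarDualBall.eval : X →ₗ[ℝ] C(weakStarDualBall X, ℝ) where
  toFun x := ⟨fun φ => φ.1 x, (WeakDual.eval_continuous x).comp continuous_subtype_val⟩
  map_add' x y := by ext φ; simp
  map_smul' c x := by ext φ; simp

instance weakStarDualBall.instNonempty : Nonempty (weakStarDualBall X) :=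
  ⟨⟨0, by simp [weakStarDualBall]⟩⟩

/-- The test functions in the proof of the Pietsch domination theorem. -/
noncomputable def pietschFunction (p : ℝ) (hp : 0 ≤ p) (u : X →L[ℝ] Y) (C : ℝ) (x : X) :
    C(weakStarDualBall X, ℝ) :=
  ⟨fun φ => C ^ p * |weakStarDualBall.eval x φ| ^ p - ‖u x‖ ^ p,
    ((((weakStarDualBall.eval x).continuous.abs).rpow_const fun _ => Or.inr hp).const_mul _).sub continuous_const⟩

/-- Weights are absorbed by homogeneity, replacing `x i` by `w i ^ (1 / p) • x i`. The weak `ℓ^p`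
norm of the new family is attained at some `φ` by weak* compactness, and there the summing
inequality says `0 ≤ q φ`. -/
theorem exists_nonneg_of_mem_convexHull_pietschFunction {p : ℝ} (hp : 0 < p) {u : X →L[ℝ] Y}
    {C : ℝ} (hC : C ∈ summingConstants p u) {q : C(weakStarDualBall X, ℝ)}
    (hq : q ∈ convexHull ℝ (Set.range (pietschFunction p hp.le u C))) : ∃ φ, 0 ≤ q φ := by
  obtain ⟨ι, _, w, z, hw, -, hz, rfl⟩ := mem_convexHull_iff_exists_fintype.1 hq
  choose x hx using hz
  have hW : Continuous fun φ : weakStarDualBall X => ∑ i, w i * |weakStarDualBall.eval (x i) φ| ^ p :=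
    continuous_finsetSum _ fun i _ =>
      (((weakStarDualBall.eval (x i)).continuous.abs).rpow_const fun _ => Or.inr hp.le).const_mul _
  obtain ⟨φ, -, hφ⟩ := isCompact_univ.exists_isMaxOn Set.univ_nonempty hW.continuousOn
  refine ⟨φ, ?_⟩
  have hwp (i : ι) : (w i ^ (1 / p)) ^ p = w i := by
    rw [one_div, Real.rpow_inv_rpow (hw i) hp.ne']
  have hnn (ψ : weakStarDualBall X) : 0 ≤ ∑ i, w i * |weakStarDualBall.eval (x i) ψ| ^ p :=
    Finset.sum_nonneg fun i _ => mul_nonneg (hw i) (by positivity)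
  have key := sum_rpow_le_of_mem_summingConstants hC (fun i => w i ^ (1 / p) • x i)
    (R := (∑ i, w i * |weakStarDualBall.eval (x i) φ| ^ p) ^ (1 / p)) fun ψ hψ => by
      refine Real.rpow_le_rpow (Finset.sum_nonneg fun i _ => by positivity) ?_ (by positivity)
      have h1 := hφ (Set.mem_univ (⟨WeakDual.toStrongDual.symm ψ, by
        simpa [weakStarDualBall] using hψ⟩ : weakStarDualBall X))
      refine le_trans (Finset.sum_le_sum fun i _ => ?_) h1
      rw [map_smul, smul_eq_mul, abs_mul, abs_of_nonneg (Real.rpow_nonneg (hw i) _),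
        Real.mul_rpow (Real.rpow_nonneg (hw i) _) (abs_nonneg _), hwp]
      rfl
  have h2 := Real.rpow_le_rpow (Real.rpow_nonneg (Finset.sum_nonneg fun i _ => by positivity) _)
    key hp.le
  rw [Real.mul_rpow hC.1 (Real.rpow_nonneg (hnn _) _), one_div,
    Real.rpow_inv_rpow (hnn _) hp.ne', Real.rpow_inv_rpow
      (Finset.sum_nonneg fun i _ => by positivity) hp.ne', Finset.mul_sum] at h2
  simp only [← hx, ContinuousMap.coe_sum, Finset.sum_apply, ContinuousMap.smul_apply, smul_eq_mul,
    pietschFunction, ContinuousMap.coe_mk, mul_sub, Finset.sum_sub_distrib, sub_nonneg]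
  refine le_trans (le_of_eq ?_) (h2.trans (le_of_eq ?_))
  · refine Finset.sum_congr rfl fun i _ => ?_
    rw [← one_div, map_smul, norm_smul, Real.norm_of_nonneg (Real.rpow_nonneg (hw i) _),
      Real.mul_rpow (Real.rpow_nonneg (hw i) _) (norm_nonneg _), hwp]
  · exact Finset.sum_congr rfl fun i _ => by ring

/-- A strictly positive functional on `C(K)` normalizes to a regular probability measure. -/
theorem exists_isProbabilityMeasure_integral_eq {K : Type*} [TopologicalSpace K] [CompactSpace K]
    [T2Space K] [MeasurableSpace K] [BorelSpace K] (Λ : StrongDual ℝ C(K, ℝ))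
    (hΛ : ∀ h : C(K, ℝ), (∀ x, 0 ≤ h x) → 0 ≤ Λ h) (h1 : 0 < Λ 1) :
    ∃ η : Measure K, IsProbabilityMeasure η ∧ η.Regular ∧
      ∀ h : C(K, ℝ), ∫ x, h x ∂η = (Λ 1)⁻¹ * Λ h := by
  let P : CompactlySupportedContinuousMap K ℝ →ₚ[ℝ] ℝ :=
    { toFun g := (Λ 1)⁻¹ * Λ g.toContinuousMap
      map_add' g g' := by
        rw [← mul_add, ← map_add]; rfl
      map_smul' c g := by
        rw [RingHom.id_apply, smul_eq_mul, mul_left_comm, ← smul_eq_mul c, ← map_smul]; rfl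
      monotone' g g' hgg' := by
        refine mul_le_mul_of_nonneg_left ?_ (inv_nonneg.2 h1.le)
        rw [← sub_nonneg, ← map_sub]
        exact hΛ _ fun x => sub_nonneg.2 (hgg' x) }
  have hP (h : C(K, ℝ)) : ∫ x, h x ∂(RealRMK.rieszMeasure P) = (Λ 1)⁻¹ * Λ h :=
    RealRMK.integral_rieszMeasure P (CompactlySupportedContinuousMap.continuousMapEquiv h)
  refine ⟨RealRMK.rieszMeasure P, ⟨?_⟩, inferInstance, hP⟩
  have := hP 1
  rw [inv_mul_cancel₀ h1.ne'] at this
  simpa [Measure.real, ENNReal.toReal_eq_one_iff] using this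

/-- The **Pietsch domination theorem**. -/
theorem exists_pietsch_measure [MeasurableSpace (weakStarDualBall X)]
    [BorelSpace (weakStarDualBall X)] {p : ℝ} (hp : 0 < p) {u : X →L[ℝ] Y}
    {C : ℝ} (hC : C ∈ summingConstants p u) :
    ∃ η : Measure (weakStarDualBall X), IsProbabilityMeasure η ∧ η.Regular ∧
      ∀ x, ‖u x‖ ^ p ≤ C ^ p * ∫ φ, |weakStarDualBall.eval x φ| ^ p ∂η := by
  -- The strictly negative functions form an open convex set missing the hull of the test functions;
  -- a separating functional, normalized, is the required measure.
  let N : Set C(weakStarDualBall X, ℝ) := {h | Set.MapsTo h Set.univ (Set.Iio 0)}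
  have hNopen : IsOpen N := ContinuousMap.isOpen_setOfPred_mapsTo isCompact_univ isOpen_Iio
  have hNconv : Convex ℝ N := by
    intro h hh k hk a b ha hb hab φ _
    exact convex_Iio (0 : ℝ) (hh (Set.mem_univ φ)) (hk (Set.mem_univ φ)) ha hb hab
  have hdisj : Disjoint N (convexHull ℝ (Set.range (pietschFunction p hp.le u C))) := by
    rw [Set.disjoint_left]
    intro q hqN hq
    obtain ⟨φ, hφ⟩ := exists_nonneg_of_mem_convexHull_pietschFunction hp hC hq
    exact absurd (hqN (Set.mem_univ φ)) (not_lt.2 hφ)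
  obtain ⟨Λ, t, hΛ1, hΛ2⟩ := geometric_hahn_banach_open hNconv hNopen (convex_convexHull ℝ _) hdisj
  have hg (x : X) : t ≤ Λ (pietschFunction p hp.le u C x) :=
    hΛ2 _ (subset_convexHull ℝ _ ⟨x, rfl⟩)
  -- The separating constant is `0`: the test function of `0` vanishes, and small negative constants
  -- lie in `N`.
  have ht0 : t ≤ 0 := by
    have : pietschFunction p hp.le u C 0 = 0 := by
      ext φ; simp [pietschFunction, Real.zero_rpow hp.ne']
    simpa [this] using hg 0
  have hconst {ε : ℝ} (hε : 0 < ε) : -(ε * Λ 1) < t := by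
    have := hΛ1 (-(ε • 1)) fun φ _ => by simpa using hε
    simpa using this
  have hpos : 0 < Λ 1 := by have := hconst one_pos; linarith
  have htn : 0 ≤ t := by
    by_contra! ht
    have := hconst (ε := -t / (2 * Λ 1)) (div_pos (by linarith) (by linarith))
    have h2 : -t / (2 * Λ 1) * Λ 1 = -t / 2 := by field_simp
    linarith
  have hΛpos (h : C(weakStarDualBall X, ℝ)) (hh : ∀ φ, 0 ≤ h φ) : 0 ≤ Λ h := by
    by_contra! hneg
    have := hΛ1 (-(h + (-Λ h / (2 * Λ 1)) • 1)) fun φ _ => by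
      have h1 := hh φ
      have h2 : 0 < -Λ h / (2 * Λ 1) := div_pos (by linarith) (by linarith)
      simp only [ContinuousMap.neg_apply, ContinuousMap.add_apply, ContinuousMap.smul_apply,
        ContinuousMap.one_apply, smul_eq_mul, mul_one, Set.mem_Iio]
      linarith
    have h2 : -Λ h / (2 * Λ 1) * Λ 1 = -Λ h / 2 := by field_simp
    rw [map_neg, map_add, map_smul, smul_eq_mul, h2] at this
    linarith
  obtain ⟨η, hη1, hη2, hη3⟩ := exists_isProbabilityMeasure_integral_eq Λ hΛpos hpos
  refine ⟨η, hη1, hη2, fun x => ?_⟩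
  have h1 : 0 ≤ ∫ φ, pietschFunction p hp.le u C x φ ∂η := by
    rw [hη3]
    exact mul_nonneg (inv_nonneg.2 hpos.le) (htn.trans (hg x))
  have hint : Integrable (fun φ => |weakStarDualBall.eval x φ| ^ p) η :=
    (((weakStarDualBall.eval x).continuous.abs).rpow_const
      fun _ => Or.inr hp.le).integrable_of_hasCompactSupport (HasCompactSupport.of_compactSpace _)
  simp only [pietschFunction, ContinuousMap.coe_mk] at h1
  rw [integral_sub (hint.const_mul _) (integrable_const _), integral_const_mul] at h1
  simpa using h1

/-- The estimate makes `u` factor through `J` as a Lipschitz map on the range of `J`, which inherits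
second countability from `Z`. -/
theorem isSeparable_range_of_norm_le {Z : Type*} [SeminormedAddCommGroup Z] [NormedSpace ℝ Z]
    [SecondCountableTopology Z] (J : X →ₗ[ℝ] Z) (u : X →L[ℝ] Y) {C : ℝ} (hC : 0 ≤ C)
    (h : ∀ x, ‖u x‖ ≤ C * ‖J x‖) : TopologicalSpace.IsSeparable (Set.range u) := by
  choose s hs using fun z : Set.range J => z.2
  have hlip : LipschitzWith C.toNNReal fun z => u (s z) := by
    refine LipschitzWith.of_dist_le_mul fun z z' => ?_
    rw [dist_eq_norm, ← map_sub, Subtype.dist_eq, dist_eq_norm, ← hs z, ← hs z', ← map_sub,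
      Real.coe_toNNReal _ hC]
    exact h _
  refine (TopologicalSpace.isSeparable_range hlip.continuous).mono ?_
  rintro _ ⟨x, rfl⟩
  refine ⟨⟨J x, x, rfl⟩, ?_⟩
  have := h (s ⟨J x, x, rfl⟩ - x)
  rw [map_sub, map_sub, hs, sub_self, norm_zero, mul_zero] at this
  exact sub_eq_zero.1 (norm_le_zero_iff.1 this)

theorem isSeparable_range_of_isPSumming {p : ℝ} (hp : 1 ≤ p)
    (hMS : IsClassMS (weakStarDualBall X)) {u : X →L[ℝ] Y} (hu : IsPSumming p u) :
    TopologicalSpace.IsSeparable (Set.range u) := by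
  obtain ⟨C, hC⟩ := hu
  let _ : MeasurableSpace (weakStarDualBall X) := borel _
  have : BorelSpace (weakStarDualBall X) := ⟨rfl⟩
  have hp0 : 0 < p := by linarith
  obtain ⟨η, _, _, hη⟩ := exists_pietsch_measure hp0 hC
  have : MeasureTheory.IsSeparable η := hMS η
  have : Fact (1 ≤ ENNReal.ofReal p) := ⟨by simpa using hp⟩
  have : Fact (ENNReal.ofReal p ≠ ∞) := ⟨ENNReal.ofReal_ne_top⟩
  refine isSeparable_range_of_norm_le
    ((ContinuousMap.toLp (E := ℝ) (ENNReal.ofReal p) η ℝ).toLinearMap ∘ₗ weakStarDualBall.eval)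
    u hC.1 fun x => ?_
  have hnorm : ‖ContinuousMap.toLp (E := ℝ) (ENNReal.ofReal p) η ℝ (weakStarDualBall.eval x)‖ =
      (∫ φ, |weakStarDualBall.eval x φ| ^ p ∂η) ^ p⁻¹ := by
    rw [Lp.norm_def, eLpNorm_congr_ae (ContinuousMap.coeFn_toLp (𝕜 := ℝ) η _),
      MemLp.eLpNorm_eq_integral_rpow_norm (by simpa using hp0) (by simp)
        ((memLp_congr_ae (ContinuousMap.coeFn_toLp (𝕜 := ℝ) η _)).1 (Lp.memLp _)),
      ENNReal.toReal_ofReal hp0.le, ENNReal.toReal_ofReal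
        (Real.rpow_nonneg (integral_nonneg fun _ => by positivity) _)]
    rfl
  change ‖u x‖ ≤ C * ‖ContinuousMap.toLp (E := ℝ) (ENNReal.ofReal p) η ℝ _‖
  have hI : 0 ≤ ∫ φ, |weakStarDualBall.eval x φ| ^ p ∂η := integral_nonneg fun _ => by positivity
  rw [hnorm, ← Real.rpow_le_rpow_iff (norm_nonneg _)
    (mul_nonneg hC.1 (Real.rpow_nonneg hI _)) hp0,
    Real.mul_rpow hC.1 (Real.rpow_nonneg hI _), Real.rpow_inv_rpow hI hp0.ne']
  exact hη x

end Pietsch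

/-! ### Pettis measurability -/

section Pettis

variable {Ω Y : Type*} [MeasurableSpace Ω] [NormedAddCommGroup Y] [NormedSpace ℝ Y]

theorem measurable_norm_sub_of_forall_dual {g : Ω → Y}
    (hsep : TopologicalSpace.IsSeparable (Set.range g))
    (hg : ∀ φ : StrongDual ℝ Y, Measurable fun ω => φ (g ω)) (a : Y) :
    Measurable fun ω => ‖g ω - a‖ := by
  obtain ⟨D, hD, hgD⟩ := hsep
  choose l hl1 hl2 using fun y : Y => exists_dual_vector'' ℝ y
  refine measurable_of_Ioi fun r => ?_
  -- Functionals norming `d - a`, for `d` in a countable dense set, suffice to detect the norm of `g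
  -- ω - a`.
  have : (fun ω => ‖g ω - a‖) ⁻¹' Set.Ioi r =
      ⋃ d ∈ D, (fun ω => l (d - a) (g ω)) ⁻¹' Set.Ioi (r + l (d - a) a) := by
    ext ω
    simp only [Set.mem_preimage, Set.mem_Ioi, Set.mem_iUnion, exists_prop]
    constructor
    · intro h
      obtain ⟨d, hd, hdist⟩ := Metric.mem_closure_iff.1 (hgD ⟨ω, rfl⟩) ((‖g ω - a‖ - r) / 2)
        (by linarith)
      refine ⟨d, hd, ?_⟩
      rw [dist_eq_norm] at hdist
      have h1 : l (d - a) (d - a) = ‖d - a‖ := hl2 _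
      have h2 : |l (d - a) (g ω - d)| ≤ ‖g ω - d‖ :=
        ((l (d - a)).le_opNorm _).trans (by nlinarith [hl1 (d - a), norm_nonneg (g ω - d)])
      have h3 : ‖g ω - a‖ ≤ ‖g ω - d‖ + ‖d - a‖ := norm_sub_le_norm_sub_add_norm_sub _ _ _
      rw [map_sub] at h1 h2
      linarith [neg_abs_le (l (d - a) (g ω) - l (d - a) d)]
    · rintro ⟨d, -, h⟩
      have h2 : |l (d - a) (g ω - a)| ≤ ‖g ω - a‖ :=
        ((l (d - a)).le_opNorm _).trans (by nlinarith [hl1 (d - a), norm_nonneg (g ω - a)])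
      rw [map_sub] at h2
      linarith [le_abs_self (l (d - a) (g ω) - l (d - a) a)]
  rw [this]
  exact MeasurableSet.biUnion hD fun d _ => hg _ measurableSet_Ioi

/-- The **Pettis measurability theorem**. -/
theorem stronglyMeasurable_of_forall_dual {g : Ω → Y}
    (hsep : TopologicalSpace.IsSeparable (Set.range g))
    (hg : ∀ φ : StrongDual ℝ Y, Measurable fun ω => φ (g ω)) : StronglyMeasurable g := by
  let _ : MeasurableSpace Y := borel Y
  have : BorelSpace Y := ⟨rfl⟩
  refine stronglyMeasurable_iff_measurable_separable.2 ⟨?_, hsep⟩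
  have hnorm := measurable_norm_sub_of_forall_dual hsep hg
  obtain ⟨D, hD, hgD⟩ := hsep
  refine measurable_of_isOpen fun U hU => ?_
  have : g ⁻¹' U = ⋃ d ∈ D, ⋃ q : ℚ, ⋃ _ : Metric.ball d (q : ℝ) ⊆ U,
      (fun ω => ‖g ω - d‖) ⁻¹' Set.Iio (q : ℝ) := by
    ext ω
    simp only [Set.mem_preimage, Set.mem_Iio, Set.mem_iUnion, exists_prop]
    constructor
    · intro h
      obtain ⟨ε, hε, hball⟩ := Metric.isOpen_iff.1 hU _ h
      obtain ⟨d, hd, hdist⟩ := Metric.mem_closure_iff.1 (hgD ⟨ω, rfl⟩) (ε / 2) (by linarith)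
      obtain ⟨q, hq1, hq2⟩ := exists_rat_btwn hdist
      refine ⟨d, hd, q, fun y hy => hball ?_, by rwa [← dist_eq_norm]⟩
      rw [Metric.mem_ball] at hy ⊢
      linarith [dist_triangle_right y (g ω) d]
    · rintro ⟨d, -, q, hq, h⟩
      exact hq (by rwa [Metric.mem_ball, dist_eq_norm])
  rw [this]
  exact MeasurableSet.biUnion hD fun d _ => MeasurableSet.iUnion fun q =>
    MeasurableSet.iUnion fun _ => hnorm d measurableSet_Iio

end Pettis

/-! ### Finiteness of the Dunford norm -/

section Dunford

variable {Ω X : Type*} [MeasurableSpace Ω] {μ : Measure Ω} [NormedAddCommGroup X]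
  [NormedSpace ℝ X] {p : ℝ} {f : Ω → X}

/-- Closed graph theorem for `φ ↦ φ ∘ f`: an `L^p` limit is an a.e. limit along a subsequence, and
norm convergence in the dual fixes the pointwise limit. -/
theorem pDunfordNorm_ne_top (hp : 1 ≤ p) (hf : IsPDunfordIntegrable p μ f) :
    pDunfordNorm p μ f ≠ ∞ := by
  have : Fact (1 ≤ ENNReal.ofReal p) := ⟨by simpa using hp⟩
  let T : StrongDual ℝ X →ₗ[ℝ] Lp ℝ (ENNReal.ofReal p) μ :=
    { toFun φ := (hf φ).toLp
      map_add' φ ψ := MemLp.toLp_add (hf φ) (hf ψ)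
      map_smul' c φ := MemLp.toLp_const_smul c (hf φ) }
  have hT : Continuous T := by
    refine T.continuous_of_seq_closed_graph fun φ φ₀ y hφ hy => ?_
    obtain ⟨ns, hmono, hns⟩ := (tendstoInMeasure_of_tendsto_Lp hy).exists_seq_tendsto_ae
    have hall : ∀ᵐ ω ∂μ, ∀ n, (T (φ n) : Ω → ℝ) ω = φ n (f ω) :=
      ae_all_iff.2 fun n => (hf (φ n)).coeFn_toLp
    refine Lp.ext ?_
    filter_upwards [hns, hall, (hf φ₀).coeFn_toLp] with ω h1 h2 h3
    refine tendsto_nhds_unique h1 ?_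
    change Filter.Tendsto _ _ (nhds ((T φ₀ : Ω → ℝ) ω))
    rw [show (T φ₀ : Ω → ℝ) ω = φ₀ (f ω) from h3]
    simp only [Function.comp_apply, h2]
    exact ((ContinuousLinearMap.apply ℝ ℝ (f ω)).continuous.tendsto φ₀).comp
      (hφ.comp hmono.tendsto_atTop)
  let T' : StrongDual ℝ X →L[ℝ] Lp ℝ (ENNReal.ofReal p) μ := ⟨T, hT⟩
  refine ne_top_of_le_ne_top (ENNReal.ofReal_ne_top (r := ‖T'‖)) (iSup_le fun φ => ?_)
  have h1 : ‖T' φ.1‖ ≤ ‖T'‖ :=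
    (T'.le_opNorm _).trans (mul_le_of_le_one_right (norm_nonneg _) (mem_closedBall_zero_iff.1 φ.2))
  have h2 : ‖T' φ.1‖ = (eLpNorm (fun ω => φ.1 (f ω)) (ENNReal.ofReal p) μ).toReal :=
    Lp.norm_toLp _ (hf φ.1)
  rw [h2] at h1
  exact (ENNReal.le_ofReal_iff_toReal_le (hf φ.1).eLpNorm_ne_top (norm_nonneg T')).2 h1

theorem toReal_eLpNorm_dual_le (hp : 1 ≤ p) (hf : IsPDunfordIntegrable p μ f)
    (φ : StrongDual ℝ X) :
    (eLpNorm (fun ω => φ (f ω)) (ENNReal.ofReal p) μ).toReal ≤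
      ‖φ‖ * (pDunfordNorm p μ f).toReal := by
  rcases eq_or_ne φ 0 with rfl | hφ
  · simp
  have hn : ‖φ‖ ≠ 0 := norm_ne_zero_iff.2 hφ
  have h1 : eLpNorm (fun ω => (‖φ‖⁻¹ • φ) (f ω)) (ENNReal.ofReal p) μ ≤ pDunfordNorm p μ f :=
    le_iSup (fun φ : Metric.closedBall (0 : StrongDual ℝ X) 1 =>
      eLpNorm (fun ω => φ.1 (f ω)) (ENNReal.ofReal p) μ)
      ⟨‖φ‖⁻¹ • φ, by simp [norm_smul, hn]⟩
  have h2 : (fun ω => φ (f ω)) = ‖φ‖ • fun ω => (‖φ‖⁻¹ • φ) (f ω) := by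
    ext ω; simp [hn]
  rw [h2, eLpNorm_const_smul, ENNReal.toReal_mul, toReal_enorm, norm_norm]
  gcongr
  exact pDunfordNorm_ne_top hp hf

end Dunford

/-! ### The norm estimate -/

section Main

variable {Ω X Y : Type*} [MeasurableSpace Ω] {μ : Measure Ω} [IsProbabilityMeasure μ]
  [NormedAddCommGroup X] [NormedSpace ℝ X] [NormedAddCommGroup Y] [NormedSpace ℝ Y]

/-- On `A i`, both `u (f ω)` and `u (x i)` lie within `ε` of `y i`. Minkowski's inequality separates
the resulting error `2 * ε`, whose total contribution is at most `2 * ε` because `μ` has mass `1`.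
-/
theorem sum_lintegral_le {ι : Type*} [Fintype ι]
    {A : ι → Set Ω} (hA : ∀ i, MeasurableSet (A i))
    (hd : Pairwise (Function.onFun Disjoint A)) (h0 : ∀ i, μ (A i) ≠ 0) {p : ℝ} (hp : 1 ≤ p)
    {f : Ω → X} (hf : IsPDunfordIntegrable p μ f) {M ε : ℝ} (hM : 0 ≤ M) (hε : 0 < ε)
    (hfM : ∀ φ : StrongDual ℝ X,
      (eLpNorm (fun ω => φ (f ω)) (ENNReal.ofReal p) μ).toReal ≤ ‖φ‖ * M)
    {u : X →L[ℝ] Y} {C : ℝ} (hC : C ∈ summingConstants p u) (y : ι → Y)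
    (hy : ∀ i, ∀ ω ∈ A i, ‖u (f ω) - y i‖ < ε) :
    ∑ i, ∫⁻ ω in A i, ‖u (f ω)‖ₑ ^ p ∂μ ≤
      ENNReal.ofReal ((C * ((1 + ε) * (M + ε)) + 2 * ε) ^ p) := by
  have hp0 : 0 < p := by linarith
  obtain ⟨x, hx1, hx2⟩ := exists_mem_convexHull_sum_rpow_le hA hd h0 hp hf hM hε hfM hC
  have hux (i : ι) : u (x i) ∈ Metric.ball (y i) ε := by
    refine convexHull_min (t := u ⁻¹' Metric.ball (y i) ε) ?_
      ((convex_ball _ _).linear_preimage u.toLinearMap) (hx1 i)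
    rintro _ ⟨ω, hω, rfl⟩
    simpa [dist_eq_norm] using hy i ω hω
  have hbd (i : ι) : ∀ ω ∈ A i, ‖u (f ω)‖ ≤ ‖u (x i)‖ + 2 * ε := fun ω hω => by
    have h1 := hux i
    rw [mem_ball_iff_norm'] at h1
    have h2 := hy i ω hω
    have h3 := norm_add₃_le (a := u (f ω) - y i) (b := y i - u (x i)) (c := u (x i))
    rw [sub_add_sub_cancel, sub_add_cancel] at h3
    linarith
  have hμp (i : ι) : (μ.real (A i) ^ (1 / p)) ^ p = μ.real (A i) := by
    rw [one_div, Real.rpow_inv_rpow measureReal_nonneg hp0.ne']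
  have hterm (i : ι) : ∫⁻ ω in A i, ‖u (f ω)‖ₑ ^ p ∂μ ≤
      ENNReal.ofReal ((μ.real (A i) ^ (1 / p) * ‖u (x i)‖ +
        μ.real (A i) ^ (1 / p) * (2 * ε)) ^ p) := by
    calc ∫⁻ ω in A i, ‖u (f ω)‖ₑ ^ p ∂μ
        ≤ ∫⁻ _ in A i, ENNReal.ofReal ((‖u (x i)‖ + 2 * ε) ^ p) ∂μ := by
          refine setLIntegral_mono' (hA i) fun ω hω => ?_
          rw [← ofReal_norm, ENNReal.ofReal_rpow_of_nonneg (norm_nonneg _) hp0.le]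
          exact ENNReal.ofReal_le_ofReal
            (Real.rpow_le_rpow (norm_nonneg _) (hbd i ω hω) hp0.le)
      _ = _ := by
          rw [setLIntegral_const, ← mul_add, Real.mul_rpow (by positivity) (by positivity), hμp,
            mul_comm, ENNReal.ofReal_mul measureReal_nonneg, ofReal_measureReal]
  refine (Finset.sum_le_sum fun i _ => hterm i).trans ?_
  rw [← ENNReal.ofReal_sum_of_nonneg fun i _ => by positivity]
  refine ENNReal.ofReal_le_ofReal ?_
  have hmeas : ∑ i, μ.real (A i) ≤ 1 := by
    rw [← measureReal_iUnion_fintype hd hA]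
    exact measureReal_le_one
  have h2 : (∑ i, (μ.real (A i) ^ (1 / p) * (2 * ε)) ^ p) ^ (1 / p) ≤ 2 * ε := by
    rw [one_div, Real.rpow_inv_le_iff_of_pos (by positivity) (by positivity) hp0]
    have (i : ι) : (μ.real (A i) ^ p⁻¹ * (2 * ε)) ^ p = μ.real (A i) * (2 * ε) ^ p := by
      rw [Real.mul_rpow (by positivity) (by positivity), ← one_div, hμp]
    simp only [this, ← Finset.sum_mul]
    exact mul_le_of_le_one_left (by positivity) hmeas
  have h3 := Real.Lp_add_le_of_nonneg Finset.univ hp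
    (f := fun i => μ.real (A i) ^ (1 / p) * ‖u (x i)‖)
    (g := fun i => μ.real (A i) ^ (1 / p) * (2 * ε))
    (fun i _ => by positivity) (fun i _ => by positivity)
  have h4 := h3.trans (add_le_add hx2 h2)
  have hC0 : 0 ≤ C := hC.1
  rwa [one_div, Real.rpow_inv_le_iff_of_pos (Finset.sum_nonneg fun i _ => by positivity)
    (by positivity) hp0, ← one_div] at h4

theorem eLpNorm_comp_le_of_mem_summingConstants {p : ℝ} (hp : 1 ≤ p)
    {f : Ω → X} (hf : IsPDunfordIntegrable p μ f) {M : ℝ} (hM : 0 ≤ M)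
    (hfM : ∀ φ : StrongDual ℝ X,
      (eLpNorm (fun ω => φ (f ω)) (ENNReal.ofReal p) μ).toReal ≤ ‖φ‖ * M)
    {u : X →L[ℝ] Y} {C : ℝ} (hC : C ∈ summingConstants p u)
    (hu : StronglyMeasurable fun ω => u (f ω)) :
    eLpNorm (fun ω => u (f ω)) (ENNReal.ofReal p) μ ≤ ENNReal.ofReal (C * M) := by
  have hp0 : 0 < p := by linarith
  have hC0 : 0 ≤ C := hC.1
  have key (ε : ℝ) (hε : 0 < ε) : eLpNorm (fun ω => u (f ω)) (ENNReal.ofReal p) μ ≤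
      ENNReal.ofReal (C * ((1 + ε) * (M + ε)) + 2 * ε) := by
    rw [eLpNorm_eq_lintegral_rpow_enorm_toReal (by simpa using hp0) (by simp),
      ENNReal.toReal_ofReal hp0.le, one_div, ENNReal.rpow_inv_le_iff hp0,
      ENNReal.ofReal_rpow_of_nonneg (by positivity) hp0.le]
    obtain ⟨D, hD, hgD⟩ := hu.isSeparable_range
    have : Nonempty Ω := μ.nonempty_of_neZero
    have hDne : D.Nonempty := closure_nonempty_iff.1 ((Set.range_nonempty _).mono hgD)
    obtain ⟨y, rfl⟩ := hD.exists_eq_range hDne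
    let B (j : ℕ) : Set Ω := {ω | ‖u (f ω) - y j‖ < ε}
    have hB (j : ℕ) : MeasurableSet (B j) :=
      (hu.sub stronglyMeasurable_const).norm.measurable measurableSet_Iio
    have hcover : ⋃ j, disjointed B j = Set.univ := by
      rw [iUnion_disjointed, Set.eq_univ_iff_forall]
      intro ω
      obtain ⟨_, ⟨j, rfl⟩, hj⟩ := Metric.mem_closure_iff.1 (hgD ⟨ω, rfl⟩) ε hε
      exact Set.mem_iUnion.2 ⟨j, by simpa [B, dist_eq_norm] using hj⟩
    rw [← setLIntegral_univ, ← hcover, lintegral_iUnion (fun j => .disjointed hB j)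
      (disjoint_disjointed B), ENNReal.tsum_eq_iSup_sum]
    refine iSup_le fun s => ?_
    classical
    -- Null pieces are dropped because averages over the pieces require positive measure.
    rw [← Finset.sum_filter_of_ne (p := fun j => μ (disjointed B j) ≠ 0) fun j _ h h' =>
      h (setLIntegral_measure_zero _ _ h'), ← Finset.sum_coe_sort]
    exact sum_lintegral_le (ι := {j // j ∈ s.filter fun j => μ (disjointed B j) ≠ 0})
      (A := fun j => disjointed B j.1) (fun j => .disjointed hB _)
      (fun i j hij => disjoint_disjointed B fun h => hij (Subtype.ext h))
      (fun j => (Finset.mem_filter.1 j.2).2) hp hf hM hε hfM hC (fun j => y j.1)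
      fun j ω hω => disjointed_subset B j hω
  have hlim : Filter.Tendsto
      (fun ε : ℝ => ENNReal.ofReal (C * ((1 + ε) * (M + ε)) + 2 * ε))
      (nhdsWithin 0 (Set.Ioi 0)) (nhds (ENNReal.ofReal (C * M))) := by
    have : Continuous fun ε : ℝ => ENNReal.ofReal (C * ((1 + ε) * (M + ε)) + 2 * ε) :=
      ENNReal.continuous_ofReal.comp (by fun_prop)
    simpa using (this.tendsto 0).mono_left nhdsWithin_le_nhds
  refine ge_of_tendsto hlim ?_
  filter_upwards [self_mem_nhdsWithin] with ε hε using key ε hε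

end Main

theorem corollary4p10
    {Ω : Type*} [MeasurableSpace Ω] (μ : Measure Ω) [IsProbabilityMeasure μ] [μ.IsComplete]
    {X : Type*} [NormedAddCommGroup X] [NormedSpace ℝ X] [CompleteSpace X]
    {Y : Type*} [NormedAddCommGroup Y] [NormedSpace ℝ Y] [CompleteSpace Y]
    (p : ℝ) (hp : 1 ≤ p)
    (hMS : IsClassMS (weakStarDualBall X))
    (u : X →L[ℝ] Y) (hu : IsPSumming p u)
    (f : Ω → X) (hf : IsPDunfordIntegrable p μ f) :
    MemLp (fun ω => u (f ω)) (ENNReal.ofReal p) μ ∧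
      eLpNorm (fun ω => u (f ω)) (ENNReal.ofReal p) μ ≤
        ENNReal.ofReal (piSumming p u) * pDunfordNorm p μ f := by
  -- Completeness of `μ` upgrades a.e. measurability of each `φ (u (f ω))` to measurability, as the
  -- Pettis theorem demands.
  have hsm : StronglyMeasurable fun ω => u (f ω) :=
    stronglyMeasurable_of_forall_dual
      ((isSeparable_range_of_isPSumming hp hMS hu).mono (Set.range_comp_subset_range f u))
      fun φ => (hf (φ.comp u)).aestronglyMeasurable.aemeasurable.nullMeasurable.measurable_of_complete
  have hbound (C : ℝ) (hC : C ∈ summingConstants p u) :=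
    eLpNorm_comp_le_of_mem_summingConstants hp hf ENNReal.toReal_nonneg
      (toReal_eLpNorm_dual_le hp hf) hC hsm
  obtain ⟨C₀, hC₀⟩ := hu
  have hfin : eLpNorm (fun ω => u (f ω)) (ENNReal.ofReal p) μ ≠ ∞ :=
    ne_top_of_le_ne_top ENNReal.ofReal_ne_top (hbound C₀ hC₀)
  refine ⟨⟨hsm.aestronglyMeasurable, hfin.lt_top⟩, ?_⟩
  have hpi : 0 ≤ piSumming p u := Real.sInf_nonneg fun C hC => hC.1
  rw [← ENNReal.ofReal_toReal (pDunfordNorm_ne_top hp hf), ← ENNReal.ofReal_mul hpi,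
    ENNReal.le_ofReal_iff_toReal_le hfin (by positivity)]
  have hreal (C : ℝ) (hC : C ∈ summingConstants p u) :
      (eLpNorm (fun ω => u (f ω)) (ENNReal.ofReal p) μ).toReal ≤
        C * (pDunfordNorm p μ f).toReal :=
    ENNReal.toReal_le_of_le_ofReal (mul_nonneg hC.1 ENNReal.toReal_nonneg) (hbound C hC)
  -- Passing to the infimum over `C` divides by the Dunford norm, so its vanishing is treated apart.
  rcases (ENNReal.toReal_nonneg (a := pDunfordNorm p μ f)).eq_or_lt with h | h
  · simpa [← h] using hreal C₀ hC₀
  · rw [← div_le_iff₀ h]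
    exact le_csInf ⟨C₀, hC₀⟩ fun C hC => (div_le_iff₀ h).2 (hreal C hC)
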